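/- Let $K$ be a number field with ring of integers $\mathcal O_K$, and let $\overline V$ be a hermitian vector bundle of rank $N+1$ ($N\ge 0$) over $\operatorname{Spec}\mathcal O_K$: a finitely generated projective $\mathcal O_K$-module $V$ of rank $N+1$ together with, for every embedding $\sigma: K\hookrightarrow\mathbb C$, a (positive definite) hermitian scalar product on $V_\sigma=V\otimes_{\mathcal O_K,\sigma}\mathbb C$, with associated norm $\|\cdot\|_\sigma$, these scalar products being invariant under complex conjugation. Let $\lambda_{\max}(\overline V)=\lambda_{N+1}(\overline V)$ be the last successive minimum, i.e. the infimum of the real numbers $\lambda$ for which there exist vectors $e_1,\dots,e_{N+1}\in V$, linearly independent in $V_K=V\otimes_{\mathcal O_K}K$, such that $\log\|e_i\|_\sigma\le\lambda$ for all $i$ and all $\sigma: K\hookrightarrow\mathbb C$. Let $\mathbb P_K=\operatorname{Proj}(\operatorname{Sym}(V_K^*))$ be the projective space of lines in $V_K$, and let $\Sigma\subsetneq\mathbb P_K$ be a closed subvariety (integral, i.e. irreducible over $K$ and reduced), different from $\mathbb P_K$, of projective degree $D$ (that is, its Hilbert polynomial has leading term $\frac{D}{r!}t^r$, where $r=\dim\Sigma$).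 Then there exists a nonzero vector $v\in V$ such that, for all $\sigma: K\hookrightarrow\mathbb C$, $$\log\|v\|_\sigma\le\lambda_{\max}(\overline V)+\log\bigl(D(N+1)\bigr),$$ and such that the point $[v]\in\mathbb P_K(K)$ does not lie in $\Sigma(K)$. -/

import Mathlib

open scoped TensorProduct NumberField LinearAlgebra.Projectivization Nat

noncomputable section

/-! ### Hermitian vector bundles over the spectrum of a ring of integers -/

/-- A copy of the field `ℂ`, regarded as an algebra over `𝓞 K` through the embedding `σ`. -/
def ComplexAt {K : Type*} [Field K] (_σ : K →+* ℂ) : Type := ℂ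

namespace ComplexAt

variable {K : Type*} [Field K] (σ : K →+* ℂ)

instance : Field (ComplexAt σ) := inferInstanceAs (Field ℂ)

instance : Algebra ℂ (ComplexAt σ) := inferInstanceAs (Algebra ℂ ℂ)

instance : Algebra (𝓞 K) (ComplexAt σ) :=
  RingHom.toAlgebra (S := ComplexAt σ) (σ.comp (algebraMap (𝓞 K) K))

/-- Complex conjugation, as an `𝓞 K`-linear map from `ℂ` (via `σ`) to `ℂ` (via the conjugate
embedding). -/
def conjMap : ComplexAt σ →ₗ[𝓞 K] ComplexAt (NumberField.ComplexEmbedding.conjugate σ) where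
  toFun z := (starRingEnd ℂ z : ℂ)
  map_add' x y := map_add (starRingEnd ℂ) x y
  map_smul' a x := map_mul (starRingEnd ℂ) (σ (algebraMap (𝓞 K) K a)) x

end ComplexAt

/-- The complex vector space `V_σ = ℂ ⊗ V`, the tensor product being over `𝓞 K` via `σ`. -/
abbrev ComplexFiber {K : Type*} [Field K] (σ : K →+* ℂ)
    (V : Type*) [AddCommGroup V] [Module (𝓞 K) V] : Type _ :=
  ComplexAt σ ⊗[𝓞 K] V

/-- The conjugation `z ⊗ v ↦ conj z ⊗ v` from `V_σ` to the fiber at the conjugate embedding. -/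
def ComplexFiber.conj {K : Type*} [Field K] (σ : K →+* ℂ)
    (V : Type*) [AddCommGroup V] [Module (𝓞 K) V] :
    ComplexFiber σ V →ₗ[𝓞 K] ComplexFiber (NumberField.ComplexEmbedding.conjugate σ) V :=
  LinearMap.rTensor V (ComplexAt.conjMap σ)

/-- A hermitian metric on the `𝓞 K`-module `V`: a (positive definite) hermitian scalar product on
`V_σ` for every complex embedding `σ`, the family being invariant under complex conjugation.
A hermitian vector bundle over `Spec (𝓞 K)` is a finitely generated projective module `V` with
such a metric. -/
structure HermitianMetric (K : Type*) [Field K]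
    (V : Type*) [AddCommGroup V] [Module (𝓞 K) V] where
  /-- The scalar product at `σ`. -/
  form : ∀ σ : K →+* ℂ, InnerProductSpace.Core ℂ (ComplexFiber σ V)
  conj_invariant : ∀ (σ : K →+* ℂ) (x y : ComplexFiber σ V),
    (form (NumberField.ComplexEmbedding.conjugate σ)).inner
        (ComplexFiber.conj σ V x) (ComplexFiber.conj σ V y) =
      starRingEnd ℂ ((form σ).inner x y)

namespace HermitianMetric

variable {K : Type*} [Field K] {V : Type*} [AddCommGroup V] [Module (𝓞 K) V]

/-- The norm `‖v‖_σ` of (the image in `V_σ` of) an element `v` of `V`. -/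
def norm (h : HermitianMetric K V) (σ : K →+* ℂ) (v : V) : ℝ :=
  Real.sqrt ((h.form σ).inner ((1 : ComplexAt σ) ⊗ₜ[𝓞 K] v) ((1 : ComplexAt σ) ⊗ₜ[𝓞 K] v)).re

/-- The `p`-th (logarithmic) successive minimum of `(V, h)`. -/
def successiveMinimum (h : HermitianMetric K V) (p : ℕ) : ℝ :=
  sInf {l : ℝ | ∃ e : Fin p → V,
    LinearIndependent K (fun i => (1 : K) ⊗ₜ[𝓞 K] e i) ∧
    ∀ (i : Fin p) (σ : K →+* ℂ), Real.log (h.norm σ (e i)) ≤ l}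

end HermitianMetric

/-! ### Subvarieties of the projective space `Proj (Sym (W^*))` of lines in `W` -/

/-- The homogeneous coordinate ring `Sym (W^*)` of the projective space of lines in `W`. -/
abbrev CoordRing (K : Type*) [Field K] (W : Type*) [AddCommGroup W] [Module K W] : Type _ :=
  SymmetricAlgebra K (Module.Dual K W)

namespace CoordRing

variable (K : Type*) [Field K] (W : Type*) [AddCommGroup W] [Module K W]

/-- `Sym^n (W^*)`: the forms of degree `n`, spanned by the products of `n` linear forms. -/
def forms (n : ℕ) : Submodule K (CoordRing K W) :=
  (LinearMap.range (SymmetricAlgebra.ι K (Module.Dual K W))) ^ n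

variable {K W}

/-- The value of a polynomial function at a vector. -/
def evalAt (w : W) : CoordRing K W →ₐ[K] K :=
  SymmetricAlgebra.lift (Module.Dual.eval K W w)

end CoordRing

/-- A closed subvariety (integral closed subscheme) of `Proj (Sym (W^*))`, given by its
homogeneous ideal: a homogeneous prime ideal that does not contain all the linear forms. It is
irreducible over `K`, but not necessarily geometrically irreducible. -/
structure ProjSubvariety (K : Type*) [Field K] (W : Type*) [AddCommGroup W] [Module K W] where
  /-- The ideal generated by the forms vanishing on the subvariety. -/
  ideal : Ideal (CoordRing K W)
  isPrime : ideal.IsPrime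
  homogeneous : ideal = Ideal.span {f | f ∈ ideal ∧ ∃ n : ℕ, f ∈ CoordRing.forms K W n}
  relevant : ∃ l : Module.Dual K W, SymmetricAlgebra.ι K (Module.Dual K W) l ∉ ideal

namespace ProjSubvariety

variable {K : Type*} [Field K] {W : Type*} [AddCommGroup W] [Module K W]

/-- The subvariety is not the whole projective space. -/
def IsProper (Z : ProjSubvariety K W) : Prop := Z.ideal ≠ ⊥

/-- The set of `K`-rational points: the lines in `W` on which every element of the ideal
vanishes. -/
def rationalPoints (Z : ProjSubvariety K W) : Set (ℙ K W) :=
  {x | ∀ f ∈ Z.ideal, ∀ w ∈ x.submodule, CoordRing.evalAt w f = 0}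

/-- The Hilbert function: the dimension of the degree `n` part of the homogeneous coordinate ring
of the subvariety. -/
def hilbertFunction (Z : ProjSubvariety K W) (n : ℕ) : ℕ :=
  Module.finrank K
    ((CoordRing.forms K W n).map (Ideal.Quotient.mkₐ K Z.ideal).toLinearMap)

/-- The projective degree is `D`: the Hilbert polynomial has leading coefficient `D / r!`, where
`r` is its degree (the dimension of the subvariety). -/
def HasDegree (Z : ProjSubvariety K W) (D : ℕ) : Prop :=
  ∃ p : Polynomial ℚ,
    (∀ᶠ n : ℕ in Filter.atTop, (Z.hilbertFunction n : ℚ) = p.eval (n : ℚ)) ∧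
    p.leadingCoeff * (p.natDegree ! : ℚ) = D

end ProjSubvariety

end

/-! Choose independent vectors `e i` in `V` with norms at most `exp l`, `l` close to the last
minimum. A combination of the `e i` with natural coefficients of sum at most `D` has norm at most `D
* exp l` at every embedding, so it suffices to find one off the subvariety. If a nonzero polynomial
`F` of degree at most `D` vanishes on the subvariety, the combinatorial Nullstellensatz gives such
coefficients (`MvPolynomial.exists_natCast_eval_ne_zero`).

To find `F`, let `A` be the homogeneous coordinate ring and `s` its transcendence degree. Project
the affine cone to `s` algebraically independent coordinates and one further coordinate. All
relations between these are multiples of a single `F`, of degree `e` say, and counting polynomials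
modulo `F` gives at least `e * choose (n + s) s` dimensions in degrees up to `n + e` of `A`
(`exists_mem_ker_choose_le_finrank`). Noether normalization bounds the dimension in degrees up to
`n` by `C * n ^ s` (`exists_finrank_map_restrictTotalDegree_le`). Both dimensions are partial sums
of the Hilbert function: the upper bound forces the Hilbert polynomial to have degree at most `s -
1`, and the lower bound then gives `e ≤ D` (`le_leadingCoeff_mul_factorial`). -/

/-! ### Comparison of growth rates -/

/-- A polynomial with positive coefficient in top degree is eventually bounded below by a positive
constant. -/
lemma Polynomial.exists_pos_eventually_le_eval {q : Polynomial ℚ} {t : ℕ}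
    (hq : q.natDegree ≤ t) (ht : 0 < q.coeff t) :
    ∃ δ : ℚ, 0 < δ ∧ ∀ᶠ n : ℕ in Filter.atTop, δ ≤ q.eval (n : ℚ) := by
  have hdeg : q.natDegree = t := le_antisymm hq (Polynomial.le_natDegree_of_ne_zero ht.ne')
  have hlc : 0 < q.leadingCoeff := by rwa [Polynomial.leadingCoeff, hdeg]
  rcases Nat.eq_zero_or_pos q.natDegree with h0 | h0
  · refine ⟨q.leadingCoeff, hlc, Filter.Eventually.of_forall fun n => ?_⟩
    rw [Polynomial.eq_C_of_natDegree_eq_zero h0]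
    simp
  · refine ⟨1, one_pos, ?_⟩
    have := Polynomial.tendsto_atTop_of_leadingCoeff_nonneg q
      (Polynomial.natDegree_pos_iff_degree_pos.mp h0) hlc.le
    exact (this.comp tendsto_natCast_atTop_atTop).eventually_ge_atTop 1

/-- A sequence whose increments are eventually bounded below by a positive constant takes positive
values arbitrarily far out. -/
lemma exists_pos_of_eventually_add_le {f : ℕ → ℚ} {δ : ℚ} (hδ : 0 < δ)
    (hf : ∀ᶠ n in Filter.atTop, f n + δ ≤ f (n + 1)) : ∃ᶠ n in Filter.atTop, 0 < f n := by
  obtain ⟨n₀, hn₀⟩ := Filter.eventually_atTop.mp hf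
  have key : ∀ k : ℕ, f n₀ + k * δ ≤ f (n₀ + k) := by
    intro k
    induction k with
    | zero => simp
    | succ k ih =>
      have := hn₀ (n₀ + k) (by omega)
      rw [← add_assoc]
      push_cast
      linarith
  rw [Filter.frequently_atTop]
  intro a
  obtain ⟨k, hk⟩ := exists_nat_gt (-f n₀ / δ)
  rw [div_lt_iff₀ hδ] at hk
  refine ⟨n₀ + (k + a), by omega, ?_⟩
  have h1 := key (k + a)
  have : (0 : ℚ) ≤ a * δ := by positivity
  push_cast at h1
  linarith [add_mul (k : ℚ) a δ]

lemma add_one_pow_sub_pow_le (s n : ℕ) :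
    ((n : ℚ) + 1) ^ s - (n : ℚ) ^ s ≤ s * ((n : ℚ) + 1) ^ (s - 1) := by
  induction s with
  | zero => simp
  | succ s ih =>
    have hn : (0 : ℚ) ≤ n := n.cast_nonneg
    rcases Nat.eq_zero_or_pos s with rfl | hs
    · simp
    have h2 : ((n : ℚ) + 1) ^ s = ((n : ℚ) + 1) ^ (s - 1) * (n + 1) := by
      rw [← pow_succ, Nat.sub_add_cancel hs]
    have h3 : (n : ℚ) * (((n : ℚ) + 1) ^ s - (n : ℚ) ^ s) ≤
        n * (s * ((n : ℚ) + 1) ^ (s - 1)) := mul_le_mul_of_nonneg_left ih hn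
    have h4 : (0 : ℚ) ≤ s * ((n : ℚ) + 1) ^ (s - 1) := by positivity
    have h5 : (n : ℚ) ^ (s + 1) = n * n ^ s := pow_succ' _ _
    have h6 : ((n : ℚ) + 1) ^ (s + 1) = (n + 1) * (n + 1) ^ s := pow_succ' _ _
    simp only [Nat.add_sub_cancel]
    push_cast
    nlinarith

/-- If the partial sums of an eventually polynomial function `h` lie between
`e * choose (n - e + s) s` and `C * n ^ s`, then `e` is at most the normalized leading coefficient
of the polynomial. -/
lemma le_leadingCoeff_mul_factorial {h : ℕ → ℕ} {p : Polynomial ℚ} {s e C : ℕ}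
    (hp : ∀ᶠ n : ℕ in Filter.atTop, (h n : ℚ) = p.eval (n : ℚ)) (hp0 : p ≠ 0)
    (hu : ∀ n, 1 ≤ n → ∑ m ∈ Finset.range (n + 1), h m ≤ C * n ^ s)
    (hl : ∀ n, e * (n + s).choose s ≤ ∑ m ∈ Finset.range (n + e + 1), h m) :
    (e : ℚ) ≤ p.leadingCoeff * (p.natDegree ! : ℚ) := by
  have hlc : 0 < p.leadingCoeff := by
    rcases lt_or_gt_of_ne (Polynomial.leadingCoeff_ne_zero.mpr hp0) with hneg | hpos
    · obtain ⟨δ, hδ, hev⟩ := Polynomial.exists_pos_eventually_le_eval (q := -p)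
        (t := p.natDegree) (by simp) (by simpa using hneg)
      obtain ⟨n, h1, h2⟩ := (hev.and hp).exists
      have : (0 : ℚ) ≤ h n := Nat.cast_nonneg _
      rw [Polynomial.eval_neg] at h1
      linarith
    · exact hpos
  -- Otherwise `h n` eventually exceeds `C * s * n ^ (s - 1)`, a bound for the increment of `C * n ^
  -- s`, by a fixed `δ`, and the partial sums overtake `C * n ^ s`.
  have hrs : p.natDegree + 1 ≤ s := by
    by_contra hcon
    obtain ⟨δ, hδ, hev⟩ := Polynomial.exists_pos_eventually_le_eval
      (q := p - Polynomial.C ((C : ℚ) * s) * Polynomial.X ^ (s - 1)) (t := p.natDegree)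
      ((Polynomial.natDegree_sub_le _ _).trans (max_le le_rfl
        ((Polynomial.natDegree_C_mul_X_pow_le _ _).trans (by omega)))) (by
        rw [Polynomial.coeff_sub, Polynomial.coeff_C_mul_X_pow]
        rcases Nat.eq_zero_or_pos s with rfl | hs
        · simpa using hlc
        · rw [if_neg (by omega)]
          simpa using hlc)
    have hinc : ∀ᶠ n : ℕ in Filter.atTop,
        ((∑ m ∈ Finset.range (n + 1), h m : ℕ) - (C : ℚ) * (n : ℚ) ^ s) + δ ≤
          ((∑ m ∈ Finset.range (n + 1 + 1), h m : ℕ) - (C : ℚ) * ((n + 1 : ℕ) : ℚ) ^ s) := by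
      filter_upwards [(Filter.tendsto_add_atTop_nat 1).eventually hev,
        (Filter.tendsto_add_atTop_nat 1).eventually hp] with n h1 h2
      rw [Finset.sum_range_succ _ (n + 1)]
      simp only [Polynomial.eval_sub, Polynomial.eval_mul, Polynomial.eval_C,
        Polynomial.eval_pow, Polynomial.eval_X] at h1
      push_cast at h1 h2 ⊢
      have h3 := mul_le_mul_of_nonneg_left (add_one_pow_sub_pow_le s n)
        (Nat.cast_nonneg (α := ℚ) C)
      rw [← h2] at h1
      linarith
    obtain ⟨n, hn, hn1⟩ := ((exists_pos_of_eventually_add_le hδ hinc).and_eventually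
      (Filter.eventually_ge_atTop 1)).exists
    have : ((∑ m ∈ Finset.range (n + 1), h m : ℕ) : ℚ) ≤ (C * n ^ s : ℕ) :=
      Nat.cast_le.mpr (hu n hn1)
    push_cast at this hn
    linarith
  obtain ⟨t, rfl⟩ : ∃ t, s = t + 1 := ⟨s - 1, by omega⟩
  by_contra! hcon
  have hfac : (0 : ℚ) < (t ! : ℚ) := by exact_mod_cast t.factorial_pos
  have hXe : ((Polynomial.X - Polynomial.C (e : ℚ)) ^ t).natDegree = t := by
    rw [Polynomial.natDegree_pow, Polynomial.natDegree_X_sub_C, mul_one]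
  have he : (0 : ℚ) < e := lt_of_le_of_lt (by positivity) hcon
  -- At `n + e + 1` the first term is `e * (n + 1) ^ t / t !`, at most the increment `e * choose (n
  -- + t + 1) t` of the lower bound. So if `e` were too large, the lower bound would overtake the
  -- partial sums.
  obtain ⟨δ, hδ, hev⟩ := Polynomial.exists_pos_eventually_le_eval
    (q := Polynomial.C ((e : ℚ) / t !) * (Polynomial.X - Polynomial.C (e : ℚ)) ^ t - p) (t := t)
    ((Polynomial.natDegree_sub_le _ _).trans (max_le
      ((Polynomial.natDegree_C_mul_le _ _).trans hXe.le) (by omega))) (by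
      have h1 : ((Polynomial.X - Polynomial.C (e : ℚ)) ^ t).coeff t = 1 := by
        have := ((Polynomial.monic_X_sub_C (e : ℚ)).pow t).coeff_natDegree
        rwa [hXe] at this
      rw [Polynomial.coeff_sub, Polynomial.coeff_C_mul, h1, mul_one, sub_pos]
      rcases (show p.natDegree ≤ t by omega).lt_or_eq with hlt | heq
      · rw [Polynomial.coeff_eq_zero_of_natDegree_lt hlt]
        positivity
      · rw [lt_div_iff₀ hfac, ← heq]
        exact hcon)
  have hinc : ∀ᶠ n : ℕ in Filter.atTop,
      ((e : ℚ) * (n + (t + 1)).choose (t + 1) - (∑ m ∈ Finset.range (n + e + 1), h m : ℕ)) + δ ≤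
        ((e : ℚ) * (n + 1 + (t + 1)).choose (t + 1) -
          (∑ m ∈ Finset.range (n + 1 + e + 1), h m : ℕ)) := by
    filter_upwards [(Filter.tendsto_add_atTop_nat (e + 1)).eventually hev,
      (Filter.tendsto_add_atTop_nat (e + 1)).eventually hp] with n h1 h2
    rw [show n + 1 + e + 1 = (n + e + 1) + 1 by ring, Finset.sum_range_succ _ (n + e + 1),
      show n + 1 + (t + 1) = (n + (t + 1)) + 1 by ring, Nat.choose_succ_succ']
    have h3 : ((n : ℚ) + 1) ^ t ≤ (t ! : ℚ) * (n + (t + 1)).choose t := by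
      have h4 := Nat.pow_sub_le_descFactorial (n + (t + 1)) t
      rw [Nat.descFactorial_eq_factorial_mul_choose] at h4
      have h5 : (n + 1) ^ t ≤ t ! * (n + (t + 1)).choose t :=
        le_trans (Nat.pow_le_pow_left (by omega) t) h4
      exact_mod_cast h5
    simp only [Polynomial.eval_sub, Polynomial.eval_mul, Polynomial.eval_C,
      Polynomial.eval_pow, Polynomial.eval_X, ← add_assoc] at h1 h2
    rw [← h2] at h1
    have h6 : (e : ℚ) / t ! * (((n + e + 1 : ℕ) : ℚ) - e) ^ t ≤
        e * (n + (t + 1)).choose t := by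
      rw [show ((n + e + 1 : ℕ) : ℚ) - e = n + 1 by push_cast; ring, div_mul_eq_mul_div,
        div_le_iff₀ hfac, mul_assoc, mul_comm ((n + (t + 1)).choose t : ℚ)]
      exact mul_le_mul_of_nonneg_left h3 he.le
    push_cast at h1 h6 ⊢
    linarith
  obtain ⟨n, hn⟩ := (exists_pos_of_eventually_add_le hδ hinc).exists
  have := (Nat.cast_le (α := ℚ)).mpr (hl n)
  push_cast at this hn
  linarith

/-! ### Polynomials of bounded degree -/

namespace MvPolynomial

variable (σ K : Type*) [Field K]

lemma card_finsupp_degree_le [Fintype σ] (n : ℕ) :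
    Nat.card {d : σ →₀ ℕ | (d.sum fun _ e => e) ≤ n} = (n + Fintype.card σ).choose n := by
  classical
  have hset : ∀ n : ℕ, {d : σ →₀ ℕ | (d.sum fun _ e => e) ≤ n} =
      ((Finset.range (n + 1)).biUnion fun m => Finset.univ.finsuppAntidiag m : Finset (σ →₀ ℕ)) := by
    intro n
    ext d
    simp [Finset.mem_finsuppAntidiag, Finsupp.sum_fintype]
  rw [hset, Nat.card_coe_set_eq, Set.ncard_coe_finset, Finset.card_biUnion]
  · induction n with
    | zero => simp [Finset.card_finsuppAntidiag_nat_eq_choose]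
    | succ n ih =>
      rw [Finset.sum_range_succ, ih, Finset.card_finsuppAntidiag_nat_eq_choose, Finset.card_univ,
        show Fintype.card σ + (n + 1) - 1 = n + Fintype.card σ by omega,
        show n + 1 + Fintype.card σ = (n + Fintype.card σ) + 1 by omega, Nat.choose_succ_succ']
  · intro a _ b _ hab
    rw [Function.onFun, Finset.disjoint_left]
    intro d hd hd'
    rw [Finset.mem_finsuppAntidiag] at hd hd'
    exact hab (hd.1.symm.trans hd'.1)

lemma finrank_restrictTotalDegree [Fintype σ] (n : ℕ) :
    Module.finrank K (restrictTotalDegree σ K n) = (n + Fintype.card σ).choose n := by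
  rw [← card_finsupp_degree_le]
  exact Module.finrank_eq_nat_card_basis (basisRestrictSupport K _)

lemma restrictTotalDegree_mul_le (m n : ℕ) :
    restrictTotalDegree σ K m * restrictTotalDegree σ K n ≤ restrictTotalDegree σ K (m + n) := by
  rw [Submodule.mul_le]
  intro f hf g hg
  rw [mem_restrictTotalDegree] at *
  exact (totalDegree_mul f g).trans (by omega)

lemma restrictTotalDegree_mono {m n : ℕ} (h : m ≤ n) :
    restrictTotalDegree σ K m ≤ restrictTotalDegree σ K n := by
  intro f hf
  rw [mem_restrictTotalDegree] at *
  omega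

/-- A monomial of degree `d ≤ n` is a product of `d` linear factors, padded by `1`. Growth estimates
thus reduce to powers of one finite-dimensional space. -/
lemma restrictTotalDegree_le_pow (n : ℕ) :
    restrictTotalDegree σ K n ≤ restrictTotalDegree σ K 1 ^ n := by
  intro f hf
  rw [mem_restrictTotalDegree] at hf
  rw [← support_sum_monomial_coeff f]
  refine Submodule.sum_mem _ fun d hd => ?_
  have h1 : (1 : Submodule K (MvPolynomial σ K)) ≤ restrictTotalDegree σ K 1 := by
    rw [Submodule.one_le, mem_restrictTotalDegree]
    simp
  have h2 : homogeneousSubmodule σ K 1 ≤ restrictTotalDegree σ K 1 := by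
    intro g hg
    rw [mem_restrictTotalDegree]
    exact IsHomogeneous.totalDegree_le hg
  have hdn : d.degree ≤ n := (le_totalDegree hd).trans hf
  have h3 := (pow_le_pow_left' h2 d.degree)
    (monomial_mem_homogeneousSubmodule_pow_degree (coeff d f) d)
  exact pow_le_pow_right' h1 hdn h3

end MvPolynomial

lemma Submodule.finrank_mul_le {K A : Type*} [Field K] [CommRing A] [Algebra K A]
    (M N : Submodule K A) [Module.Finite K M] [Module.Finite K N] :
    Module.finrank K (M * N : Submodule K A) ≤ Module.finrank K M * Module.finrank K N := by
  rw [← Module.finrank_tensorProduct (R := K), ← Submodule.mulMap_range]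
  exact LinearMap.finrank_range_le _

/-! ### Growth of finitely generated domains -/

/-- A finitely generated domain of transcendence degree `s` grows at most like `n ^ s`. -/
lemma exists_finrank_map_restrictTotalDegree_le {σ K A : Type*} [Finite σ] [Field K] [CommRing A]
    [IsDomain A] [Algebra K A] (u : MvPolynomial σ K →ₐ[K] A) (hu : Function.Surjective u) :
    ∃ (s C : ℕ), Algebra.trdeg K A = s ∧ ∀ n, 1 ≤ n →
      Module.finrank K ((MvPolynomial.restrictTotalDegree σ K n).map u.toLinearMap) ≤
        C * n ^ s := by
  have : Algebra.FiniteType K A := Algebra.FiniteType.of_surjective u hu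
  -- Noether normalization: `A` is finite over a polynomial ring in `s` variables, which `B` filters
  -- by degree.
  obtain ⟨s, g, hg, hfin⟩ := exists_finite_inj_algHom_of_fg K A
  have htr : Algebra.trdeg K A = s := by
    algebraize [g.toRingHom]
    have : FaithfulSMul (MvPolynomial (Fin s) K) A :=
      (faithfulSMul_iff_algebraMap_injective _ _).mpr hg
    have : Module.Finite (MvPolynomial (Fin s) K) A := hfin
    have h1 := lift_trdeg_add_eq K (MvPolynomial (Fin s) K) A
    have h2 : Algebra.trdeg (MvPolynomial (Fin s) K) A = 0 := trdeg_eq_zero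
    rw [h2, MvPolynomial.trdeg_of_isDomain] at h1
    simpa [eq_comm] using h1
  let B : ℕ → Submodule K A := fun m =>
    (MvPolynomial.restrictTotalDegree (Fin s) K m).map g.toLinearMap
  have hB : ∀ m n, B m * B n ≤ B (m + n) := fun m n => by
    simp only [B]
    rw [← Submodule.map_mul]
    exact Submodule.map_mono (MvPolynomial.restrictTotalDegree_mul_le _ _ _ _)
  have hBmono : Monotone B := fun m n h =>
    Submodule.map_mono (MvPolynomial.restrictTotalDegree_mono _ _ h)
  obtain ⟨S, hS⟩ : ∃ S : Finset A, ∀ a : A, ∃ m, a ∈ B m * Submodule.span K (S : Set A) := by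
    algebraize [g.toRingHom]
    have : Module.Finite (MvPolynomial (Fin s) K) A := hfin
    obtain ⟨S, hS⟩ := Module.Finite.fg_top (R := MvPolynomial (Fin s) K) (M := A)
    refine ⟨S, fun a => ?_⟩
    have ha : a ∈ Submodule.span (MvPolynomial (Fin s) K) (S : Set A) := by rw [hS]; trivial
    induction ha using Submodule.span_induction with
    | mem x hx =>
      refine ⟨0, ?_⟩
      rw [← one_mul x]
      exact Submodule.mul_mem_mul ⟨1, by simp [MvPolynomial.mem_restrictTotalDegree], by simp⟩
        (Submodule.subset_span hx)
    | zero => exact ⟨0, zero_mem _⟩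
    | add x y _ _ hx hy =>
      obtain ⟨m, hm⟩ := hx
      obtain ⟨n, hn⟩ := hy
      exact ⟨max m n, add_mem (mul_le_mul' (hBmono (le_max_left m n)) le_rfl hm)
        (mul_le_mul' (hBmono (le_max_right m n)) le_rfl hn)⟩
    | smul f x _ hx =>
      obtain ⟨m, hm⟩ := hx
      refine ⟨f.totalDegree + m, ?_⟩
      have hf : g f ∈ B f.totalDegree :=
        ⟨f, (MvPolynomial.mem_restrictTotalDegree _ _ _).mpr le_rfl, rfl⟩
      have := Submodule.mul_mem_mul hf hm
      rw [← mul_assoc] at this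
      exact mul_le_mul' (hB _ _) le_rfl this
  let G := Submodule.span K (S : Set A)
  let X := (MvPolynomial.restrictTotalDegree σ K 1).map u.toLinearMap
  have hXfg : X.FG := Module.Finite.iff_fg.mp inferInstance
  have hGfg : G.FG := ⟨S, rfl⟩
  have hGfin : Module.Finite K G := Module.Finite.iff_fg.mpr hGfg
  have hfg : (X * G ⊔ 1).FG :=
    (hXfg.mul hGfg).sup (Submodule.one_eq_span (R := K) (A := A) ▸ Submodule.fg_span_singleton 1)
  have hBfg : ∀ m, (B m).FG := fun m => Module.Finite.iff_fg.mp inferInstance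
  -- Each multiplication by `X` raises the filtration degree by at most `M`; the summand `1` starts
  -- the induction at `X ^ 0`.
  obtain ⟨M, hM⟩ : ∃ M, X * G ⊔ 1 ≤ B M * G := by
    obtain ⟨T, hT⟩ := hfg
    choose m hm using hS
    refine ⟨T.sup m, ?_⟩
    rw [← hT, Submodule.span_le]
    intro a ha
    exact mul_le_mul' (hBmono (Finset.le_sup ha)) le_rfl (hm a)
  have hXn : ∀ n, X ^ n ≤ B (M * (n + 1)) * G := by
    intro n
    induction n with
    | zero => simpa using le_sup_right.trans hM
    | succ n ih =>
      calc X ^ (n + 1) = X * X ^ n := pow_succ' _ _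
        _ ≤ X * (B (M * (n + 1)) * G) := mul_le_mul' le_rfl ih
        _ = B (M * (n + 1)) * (X * G) := by rw [mul_left_comm]
        _ ≤ B (M * (n + 1)) * (B M * G) := mul_le_mul' le_rfl (le_sup_left.trans hM)
        _ = (B (M * (n + 1)) * B M) * G := by rw [mul_assoc]
        _ ≤ B (M * (n + 1 + 1)) * G := mul_le_mul' (hB _ _) le_rfl
  -- The constant comes from `M * (n + 1) + s ≤ (2 * M + s) * n`, valid for `n ≥ 1`.
  refine ⟨s, (2 * M + s) ^ s * Module.finrank K G, htr, fun n hn => ?_⟩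
  calc Module.finrank K ((MvPolynomial.restrictTotalDegree σ K n).map u.toLinearMap)
      ≤ Module.finrank K (B (M * (n + 1)) * G : Submodule K A) := by
        have : Module.Finite K (B (M * (n + 1)) * G : Submodule K A) :=
          Module.Finite.iff_fg.mpr ((hBfg _).mul hGfg)
        apply Submodule.finrank_mono
        refine le_trans (Submodule.map_mono (MvPolynomial.restrictTotalDegree_le_pow σ K n)) ?_
        rw [Submodule.map_pow]
        exact hXn n
    _ ≤ Module.finrank K (B (M * (n + 1))) * Module.finrank K G := Submodule.finrank_mul_le _ _
    _ ≤ (2 * M + s) ^ s * n ^ s * Module.finrank K G := by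
        gcongr
        refine (Submodule.finrank_map_le _ _).trans ?_
        rw [MvPolynomial.finrank_restrictTotalDegree, Fintype.card_fin, Nat.choose_symm_add,
          ← mul_pow]
        exact (Nat.choose_le_pow _ _).trans (Nat.pow_le_pow_left (by nlinarith) _)
    _ = _ := by ring

/-! ### The lower bound -/

/-- By Pascal's rule, each increase of `e` by one adds at least `choose (n + s) s` to the right
side. This counts polynomials in `s + 1` variables modulo one of degree `e`. -/
lemma Nat.mul_choose_add_choose_le (n e s : ℕ) :
    e * (n + s).choose s + (n + (s + 1)).choose n ≤ (n + e + (s + 1)).choose (n + e) := by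
  induction e with
  | zero => simp
  | succ e ih =>
    have h1 : (n + (e + 1) + (s + 1)).choose (n + (e + 1)) =
        (n + e + (s + 1)).choose (n + e) + (n + e + (s + 1)).choose (n + e + 1) := by
      rw [← Nat.choose_succ_succ']
      congr 1
      omega
    have h2 : (n + s).choose s ≤ (n + e + (s + 1)).choose (n + e + 1) := by
      rw [show n + e + (s + 1) = (n + e + 1) + s by ring, Nat.choose_symm_add]
      exact Nat.choose_le_choose s (by omega)
    rw [h1, add_mul, one_mul]
    omega

/-- A prime ideal of `R[X]` that meets `R` trivially is principal. -/
lemma Polynomial.exists_dvd_of_isPrime_of_C_mem {R : Type*} [CommRing R] [IsDomain R]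
    [UniqueFactorizationMonoid R] (J : Ideal (Polynomial R)) [hJ : J.IsPrime] (hJ0 : J ≠ ⊥)
    (hC : ∀ r : R, Polynomial.C r ∈ J → r = 0) :
    ∃ F ∈ J, F ≠ 0 ∧ ∀ G ∈ J, F ∣ G := by
  obtain ⟨P, ⟨hP, hP0⟩, hmin⟩ := WellFounded.has_min
    (InvImage.wf Polynomial.natDegree Nat.lt_wfRel.wf) {P | P ∈ J ∧ P ≠ 0}
    (Submodule.exists_mem_ne_zero_of_ne_bot hJ0)
  -- Primality of `J` puts a prime factor of `P` in `J`, still of minimal degree.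
  obtain ⟨F, hFP, hFJ⟩ : ∃ F ∈ UniqueFactorizationMonoid.factors P, F ∈ J := by
    rw [← hJ.multiset_prod_mem_iff_exists_mem]
    exact (Ideal.mem_iff_of_associated (UniqueFactorizationMonoid.factors_prod hP0)).mpr hP
  have hF := UniqueFactorizationMonoid.prime_of_factor F hFP
  have hFdeg : F.natDegree ≤ P.natDegree :=
    Polynomial.natDegree_le_of_dvd (UniqueFactorizationMonoid.dvd_of_mem_factors hFP) hP0
  have hlow : ∀ G ∈ J, G.natDegree < F.natDegree → G = 0 := by
    intro G hG hlt
    by_contra hG0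
    exact hmin G ⟨hG, hG0⟩ (lt_of_lt_of_le hlt hFdeg)
  have hlead : ¬ F ∣ Polynomial.C F.leadingCoeff := by
    intro h
    exact Polynomial.leadingCoeff_ne_zero.mpr hF.ne_zero (hC _ (J.mem_of_dvd h hFJ))
  refine ⟨F, hFJ, hF.ne_zero, fun G => ?_⟩
  induction hd : G.natDegree using Nat.strong_induction_on generalizing G with
  | _ d ih =>
    intro hG
    rcases lt_or_ge G.natDegree F.natDegree with hlt | hge
    · rw [hlow G hG hlt]
      exact dvd_zero F
    have hF1 : 0 < F.natDegree := by
      by_contra h0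
      have h1 := Polynomial.eq_C_of_natDegree_eq_zero (Nat.eq_zero_of_not_pos h0)
      rw [h1] at hFJ
      exact hF.ne_zero (by rw [h1, hC _ hFJ, Polynomial.C_0])
    -- Pseudo-division: by induction `F` divides the remainder, hence `F.leadingCoeff * G`; being
    -- prime and not dividing the constant, it divides `G`.
    have hlt := Polynomial.natDegree_cancelLeads_lt_of_natDegree_le_natDegree hge (by omega)
    have heq : F.cancelLeads G = Polynomial.C F.leadingCoeff * G -
        Polynomial.C G.leadingCoeff * Polynomial.X ^ (G.natDegree - F.natDegree) * F := by
      rw [Polynomial.cancelLeads, Nat.sub_eq_zero_of_le hge, pow_zero, mul_one]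
    have hdvd := ih _ (hd ▸ hlt) (F.cancelLeads G) rfl (by
      rw [heq]
      exact J.sub_mem (J.mul_mem_left _ hG) (J.mul_mem_left _ hFJ))
    rw [heq, dvd_sub_left (Dvd.intro_left _ rfl)] at hdvd
    exact (hF.dvd_or_dvd hdvd).resolve_left hlead

/-- Given algebraically independent elements and one element depending on them, the relations
between them are the multiples of a single polynomial. -/
lemma MvPolynomial.exists_dvd_of_aeval_option_eq_zero {τ K A : Type*} [Field K] [CommRing A]
    [IsDomain A] [Algebra K A] {y : τ → A} (hy : AlgebraicIndependent K y) {a : A}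
    (ha : ¬ AlgebraicIndependent K (fun o : Option τ => o.elim a y)) :
    ∃ F : MvPolynomial (Option τ) K, F ≠ 0 ∧
      MvPolynomial.aeval (fun o : Option τ => o.elim a y) F = 0 ∧
      ∀ G : MvPolynomial (Option τ) K,
        MvPolynomial.aeval (fun o : Option τ => o.elim a y) G = 0 → F ∣ G := by
  set u := MvPolynomial.aeval (R := K) (fun o : Option τ => o.elim a y)
  -- Singling out the variable of `a` turns the relations into a prime ideal of `R[X]`, `R` the
  -- polynomial ring on `τ`. It meets `R` trivially because `y` is independent.
  let E := MvPolynomial.optionEquivLeft K τ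
  let w : Polynomial (MvPolynomial τ K) →ₐ[K] A := u.comp E.symm.toAlgHom
  have hprime : (RingHom.ker w).IsPrime := RingHom.ker_isPrime _
  have hCy : ∀ r, w (Polynomial.C r) = MvPolynomial.aeval y r := by
    intro r
    have : (w.comp (Algebra.ofId (MvPolynomial τ K) _ |>.restrictScalars K)) =
        MvPolynomial.aeval y := by
      ext i
      simp [w, E, u, Algebra.ofId_apply]
    exact DFunLike.congr_fun this r
  obtain ⟨F, hF, hF0, hdvd⟩ := Polynomial.exists_dvd_of_isPrime_of_C_mem (RingHom.ker w)
    (fun hbot => ha (by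
      rw [algebraicIndependent_iff_injective_aeval]
      intro f g hfg
      have hmem : E (f - g) ∈ RingHom.ker w := by
        change u (E.symm (E (f - g))) = 0
        rw [E.symm_apply_apply, map_sub, sub_eq_zero]
        exact hfg
      rw [hbot, Ideal.mem_bot] at hmem
      exact sub_eq_zero.mp ((map_eq_zero_iff E E.injective).mp hmem)))
    (fun r hr => by
      have hr' : MvPolynomial.aeval y r = 0 := (hCy r).symm.trans hr
      exact (map_eq_zero_iff _ hy).mp hr')
  refine ⟨E.symm F, fun h => hF0 ((map_eq_zero_iff E.symm E.symm.injective).mp h), hF,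
    fun G hG => ?_⟩
  have hmem : E G ∈ RingHom.ker w := by
    change u (E.symm (E G)) = 0
    rwa [E.symm_apply_apply]
  have := map_dvd E.symm (hdvd _ hmem)
  rwa [E.symm_apply_apply] at this

/-- A transcendence basis taken among the coordinates, with one more coordinate, generates a
subalgebra of `A` that is a polynomial ring in `s + 1` variables modulo one polynomial. Its
dimensions bound those of `A` from below. -/
lemma exists_mem_ker_choose_le_finrank {σ K A : Type*} [Finite σ] [Field K] [CommRing A]
    [IsDomain A] [Algebra K A] (u : MvPolynomial σ K →ₐ[K] A) (hu : Function.Surjective u)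
    (hker : ¬ Function.Injective u) {s : ℕ} (hs : Algebra.trdeg K A = s) :
    ∃ (F : MvPolynomial σ K) (e : ℕ), F ≠ 0 ∧ u F = 0 ∧ F.totalDegree ≤ e ∧ ∀ n,
      e * (n + s).choose s ≤
        Module.finrank K ((MvPolynomial.restrictTotalDegree σ K (n + e)).map u.toLinearMap) := by
  classical
  have hrange : Algebra.adjoin K (Set.range fun i => u (MvPolynomial.X i)) = ⊤ := by
    rw [← (AlgHom.range_eq_top u).mpr hu, ← Algebra.map_top, ← MvPolynomial.adjoin_range_X,
      AlgHom.map_adjoin, ← Set.range_comp]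
    rfl
  have halg : Algebra.IsAlgebraic
      (Algebra.adjoin K (Set.range fun i => u (MvPolynomial.X i))) A :=
    ⟨fun a => isAlgebraic_algebraMap
      (⟨a, by rw [hrange]; trivial⟩ :
        Algebra.adjoin K (Set.range fun i => u (MvPolynomial.X i)))⟩
  obtain ⟨T, hT, hbasis⟩ := exists_isTranscendenceBasis_subset (R := K)
    (Set.range fun i => u (MvPolynomial.X i))
  have : Finite T := ((Set.finite_range _).subset hT).to_subtype
  have : Fintype T := Fintype.ofFinite T
  have hcard : Fintype.card T = s := by
    have := hbasis.cardinalMk_eq_trdeg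
    rw [hs, Cardinal.mk_fintype] at this
    exact_mod_cast this
  choose c hc using fun a : T => hT a.2
  have hcinj : Function.Injective c := fun a b hab => Subtype.ext (by rw [← hc, ← hc, hab])
  -- If every variable came from the transcendence basis, `u` would be injective; so a further
  -- coordinate is left.
  have hcsurj : ¬ Function.Surjective c := by
    intro hcs
    refine hker ?_
    have hind : AlgebraicIndependent K fun i => u (MvPolynomial.X i) := by
      rw [← algebraicIndependent_equiv' (Equiv.ofBijective c ⟨hcinj, hcs⟩)
        (f := fun i => u (MvPolynomial.X i)) (g := ((↑) : T → A)) (funext hc)]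
      exact hbasis.1
    rw [algebraicIndependent_iff_injective_aeval] at hind
    rw [MvPolynomial.aeval_unique u]
    exact hind
  obtain ⟨j, hj⟩ : ∃ j, ∀ a, c a ≠ j := by simpa [Function.Surjective] using hcsurj
  let c' : Option T → σ := fun o => o.elim j c
  have hc' : Function.Injective c' := by
    rintro (_ | a) (_ | b) h
    · rfl
    · exact absurd h.symm (hj b)
    · exact absurd h (hj a)
    · exact congrArg some (hcinj h)
  have hdep : ¬ AlgebraicIndependent K
      (fun o : Option T => o.elim (u (MvPolynomial.X j)) ((↑) : T → A)) := by
    rw [hbasis.1.option_iff_transcendental]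
    have := hbasis.isAlgebraic
    exact fun h => h (Algebra.IsAlgebraic.isAlgebraic _)
  obtain ⟨F, hF0, hF, hdvd⟩ := MvPolynomial.exists_dvd_of_aeval_option_eq_zero hbasis.1 hdep
  have hren : MvPolynomial.aeval (R := K)
      (fun o : Option T => o.elim (u (MvPolynomial.X j)) ((↑) : T → A)) =
      u.comp (MvPolynomial.rename c') := by
    ext (_ | a)
    · simp [c']
    · simp [c', hc]
  rw [hren] at hF hdvd
  refine ⟨MvPolynomial.rename c' F, F.totalDegree,
    fun h => hF0 ((map_eq_zero_iff _ (MvPolynomial.rename_injective _ hc')).mp h), hF,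
    MvPolynomial.totalDegree_rename_le _ _, fun n => ?_⟩
  set e := F.totalDegree
  set w := (u.comp (MvPolynomial.rename c')).toLinearMap
  have hle : (MvPolynomial.restrictTotalDegree (Option T) K (n + e)).map w ≤
      (MvPolynomial.restrictTotalDegree σ K (n + e)).map u.toLinearMap := by
    rintro _ ⟨f, hf, rfl⟩
    refine ⟨MvPolynomial.rename c' f, ?_, rfl⟩
    rw [SetLike.mem_coe, MvPolynomial.mem_restrictTotalDegree] at hf ⊢
    exact (MvPolynomial.totalDegree_rename_le _ _).trans hf
  refine le_trans ?_ (Submodule.finrank_mono hle)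
  have hrn := LinearMap.finrank_range_add_finrank_ker
    (w.domRestrict (MvPolynomial.restrictTotalDegree (Option T) K (n + e)))
  -- Relations of degree at most `n + e` are `F * g'` with `g'` of degree at most `n`, as degrees
  -- add over a domain.
  have hkerle : Module.finrank K (LinearMap.ker
      (w.domRestrict (MvPolynomial.restrictTotalDegree (Option T) K (n + e)))) ≤
      (n + (s + 1)).choose n := by
    rw [← Submodule.finrank_map_subtype_eq, ← hcard, ← Fintype.card_option,
      ← MvPolynomial.finrank_restrictTotalDegree (Option T) K n]
    refine le_trans (Submodule.finrank_mono ?_) (Submodule.finrank_map_le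
      (LinearMap.mulLeft K F) (MvPolynomial.restrictTotalDegree (Option T) K n))
    rintro _ ⟨⟨g, hg⟩, hg0, rfl⟩
    obtain ⟨g', rfl⟩ := hdvd g hg0
    refine ⟨g', ?_, rfl⟩
    rw [MvPolynomial.mem_restrictTotalDegree] at hg
    rw [SetLike.mem_coe, MvPolynomial.mem_restrictTotalDegree]
    by_cases hg' : g' = 0
    · simp [hg']
    rw [MvPolynomial.totalDegree_mul_of_isDomain hF0 hg'] at hg
    omega
  rw [LinearMap.range_domRestrict, MvPolynomial.finrank_restrictTotalDegree, Fintype.card_option,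
    hcard] at hrn
  have hch := Nat.mul_choose_add_choose_le n e s
  omega

/-! ### Forms of small degree in a homogeneous prime ideal -/

section HomogeneousKernel

variable {σ K A : Type*} [Field K] [CommRing A] [IsDomain A] [Algebra K A]
  (u : MvPolynomial σ K →ₐ[K] A)

/-- If the kernel is homogeneous, the image of the polynomials of degree at most `n` is the direct
sum of the images of the forms of degree at most `n`. -/
lemma sum_finrank_map_homogeneousSubmodule [Finite σ]
    (hom : ∀ f, u f = 0 → ∀ n, u (MvPolynomial.homogeneousComponent n f) = 0) (n : ℕ) :
    ∑ m ∈ Finset.range (n + 1),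
        Module.finrank K ((MvPolynomial.homogeneousSubmodule σ K m).map u.toLinearMap) =
      Module.finrank K ((MvPolynomial.restrictTotalDegree σ K n).map u.toLinearMap) := by
  classical
  have hfin : ∀ m, Module.Finite K
      ((MvPolynomial.homogeneousSubmodule σ K m).map u.toLinearMap) := fun m =>
    Module.Finite.iff_fg.mpr ((MvPolynomial.homogeneousSubmodule_fg σ K m).map _)
  let L : (∀ m : Fin (n + 1),
      ((MvPolynomial.homogeneousSubmodule σ K m).map u.toLinearMap)) →ₗ[K] A :=
    LinearMap.lsum K _ K fun m => Submodule.subtype _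
  have hL : ∀ x, L x = ∑ m, (x m : A) := fun x => by simp [L]
  -- The homogeneous components of a relation are again relations, so the sum is direct.
  have hinj : Function.Injective L := by
    rw [injective_iff_map_eq_zero]
    intro x hx
    choose f hf hfx using fun m => (x m).2
    have h0 : u (∑ m, f m) = 0 := by
      rw [map_sum, ← hx, hL]
      exact Finset.sum_congr rfl fun m _ => hfx m
    funext m
    have h1 := hom _ h0 m
    rw [map_sum, Finset.sum_eq_single m, MvPolynomial.homogeneousComponent_of_mem (hf m),
      if_pos rfl] at h1
    · exact Subtype.ext ((hfx m).symm.trans h1)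
    · intro b _ hb
      rw [MvPolynomial.homogeneousComponent_of_mem (hf b), if_neg]
      exact fun h => hb (Fin.ext h.symm)
    · simp
  have hrange : LinearMap.range L =
      (MvPolynomial.restrictTotalDegree σ K n).map u.toLinearMap := by
    apply le_antisymm
    · rintro _ ⟨x, rfl⟩
      rw [hL]
      refine Submodule.sum_mem _ fun m _ => ?_
      obtain ⟨f, hf, hfx⟩ := (x m).2
      refine ⟨f, ?_, hfx⟩
      rw [SetLike.mem_coe, MvPolynomial.mem_restrictTotalDegree]
      exact (MvPolynomial.IsHomogeneous.totalDegree_le hf).trans (by omega)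
    · rintro _ ⟨f, hf, rfl⟩
      rw [SetLike.mem_coe, MvPolynomial.mem_restrictTotalDegree] at hf
      refine ⟨fun m => ⟨u (MvPolynomial.homogeneousComponent m f),
        _, MvPolynomial.homogeneousComponent_mem m f, rfl⟩, ?_⟩
      rw [hL]
      have h1 : f = ∑ m : Fin (n + 1), MvPolynomial.homogeneousComponent m f := by
        rw [Fin.sum_univ_eq_sum_range fun m => MvPolynomial.homogeneousComponent m f]
        conv_lhs => rw [← MvPolynomial.sum_homogeneousComponent f]
        refine Finset.sum_subset (Finset.range_mono (by omega)) fun m _ hm => ?_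
        rw [Finset.mem_range, not_lt] at hm
        exact MvPolynomial.homogeneousComponent_eq_zero _ _ (by omega)
      conv_rhs => rw [h1]
      simp
  rw [← hrange, LinearMap.finrank_range_of_inj hinj, Module.finrank_pi_fintype,
    Fin.sum_univ_eq_sum_range fun m => Module.finrank K
      ((MvPolynomial.homogeneousSubmodule σ K m).map u.toLinearMap)]

/-- A homogeneous prime ideal of degree `D` contains a nonzero polynomial of degree at
most `D`. -/
theorem exists_mem_ker_totalDegree_le [Finite σ] (hu : Function.Surjective u)
    (hker : ¬ Function.Injective u)
    (hom : ∀ f, u f = 0 → ∀ n, u (MvPolynomial.homogeneousComponent n f) = 0)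
    (hrel : ∃ i, u (MvPolynomial.X i) ≠ 0) {p : Polynomial ℚ}
    (hp : ∀ᶠ n : ℕ in Filter.atTop, (Module.finrank K
      ((MvPolynomial.homogeneousSubmodule σ K n).map u.toLinearMap) : ℚ) = p.eval (n : ℚ)) :
    ∃ F, F ≠ 0 ∧ u F = 0 ∧ (F.totalDegree : ℚ) ≤ p.leadingCoeff * (p.natDegree ! : ℚ) := by
  -- A coordinate that is nonzero in the domain `A` has nonzero powers in every degree.
  have hp0 : p ≠ 0 := by
    rintro rfl
    obtain ⟨n, hn⟩ := hp.exists
    obtain ⟨i, hi⟩ := hrel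
    have hfin : Module.Finite K
        ((MvPolynomial.homogeneousSubmodule σ K n).map u.toLinearMap) :=
      Module.Finite.iff_fg.mpr ((MvPolynomial.homogeneousSubmodule_fg σ K n).map _)
    rw [Polynomial.eval_zero, Nat.cast_eq_zero, Submodule.finrank_eq_zero] at hn
    have hmem : u (MvPolynomial.X i ^ n) ∈
        (MvPolynomial.homogeneousSubmodule σ K n).map u.toLinearMap :=
      ⟨_, MvPolynomial.isHomogeneous_X_pow i n, rfl⟩
    rw [hn, Submodule.mem_bot, map_pow] at hmem
    exact hi (eq_zero_of_pow_eq_zero hmem)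
  obtain ⟨s, C, hs, hupper⟩ := exists_finrank_map_restrictTotalDegree_le u hu
  obtain ⟨F, e, hF0, hF, hFe, hlower⟩ := exists_mem_ker_choose_le_finrank u hu hker hs
  simp only [← sum_finrank_map_homogeneousSubmodule u hom] at hupper hlower
  exact ⟨F, hF0, hF, (Nat.cast_le.mpr hFe).trans
    (le_leadingCoeff_mul_factorial hp hp0 hupper hlower)⟩

/-- The constant term of `F` lies in the kernel, and `K` embeds in `A`. Hence a point where `F` does
not vanish is not the origin. -/
lemma eval_zero_of_mem_homogeneous_ker
    (hom : ∀ f, u f = 0 → ∀ n, u (MvPolynomial.homogeneousComponent n f) = 0)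
    {F : MvPolynomial σ K} (hF : u F = 0) : MvPolynomial.eval 0 F = 0 := by
  have h := hom F hF 0
  rw [MvPolynomial.homogeneousComponent_zero, ← MvPolynomial.algebraMap_eq, AlgHom.commutes,
    map_eq_zero_iff _ (algebraMap K A).injective] at h
  rw [MvPolynomial.eval_zero, MvPolynomial.constantCoeff_eq, h]

/-- In at most one variable a homogeneous component is a monomial, and a domain in which a nonzero
monomial vanishes kills the variable. -/
lemma map_X_eq_zero_of_subsingleton [Subsingleton σ] (hker : ¬ Function.Injective u)
    (hom : ∀ f, u f = 0 → ∀ n, u (MvPolynomial.homogeneousComponent n f) = 0) (i : σ) :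
    u (MvPolynomial.X i) = 0 := by
  classical
  obtain ⟨F, hF, hF0⟩ : ∃ F, u F = 0 ∧ F ≠ 0 := by
    simpa [injective_iff_map_eq_zero] using hker
  obtain ⟨d, hd⟩ := MvPolynomial.ne_zero_iff.mp hF0
  have hdi : ∀ d : σ →₀ ℕ, d = Finsupp.single i d.degree := fun d => by
    ext j
    obtain rfl := Subsingleton.elim i j
    have : Unique σ := uniqueOfSubsingleton i
    rw [Finsupp.single_eq_same, Finsupp.degree_eq_sum, Fintype.sum_unique]
    exact congrArg d (Subsingleton.elim _ _)
  have h := hom F hF d.degree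
  have hcomp : MvPolynomial.homogeneousComponent d.degree F =
      MvPolynomial.monomial d (MvPolynomial.coeff d F) := by
    ext d'
    rw [MvPolynomial.coeff_homogeneousComponent, MvPolynomial.coeff_monomial]
    by_cases hdd : d = d'
    · simp [hdd]
    · rw [if_neg hdd, if_neg fun h => hdd ?_]
      rw [hdi d, hdi d', h]
  rw [hcomp, hdi d, ← MvPolynomial.C_mul_X_pow_eq_monomial, map_mul, map_pow,
    ← MvPolynomial.algebraMap_eq, AlgHom.commutes, mul_eq_zero, ← hdi d,
    map_eq_zero_iff _ (algebraMap K A).injective] at h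
  exact eq_zero_of_pow_eq_zero (h.resolve_left hd)

end HomogeneousKernel

/-- A nonzero polynomial of degree `d` does not vanish at some point whose coordinates are natural
numbers of sum at most `d`. -/
lemma MvPolynomial.exists_natCast_eval_ne_zero {σ K : Type*} [Fintype σ] [Field K] [CharZero K]
    {F : MvPolynomial σ K} (hF : F ≠ 0) :
    ∃ a : σ → ℕ, ∑ i, a i ≤ F.totalDegree ∧ MvPolynomial.eval (fun i => (a i : K)) F ≠ 0 := by
  classical
  obtain ⟨t, ht, htd⟩ : ∃ t ∈ F.support, F.totalDegree = t.degree :=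
    Finset.exists_mem_eq_sup _ (MvPolynomial.support_nonempty.mpr hF) _
  -- The grid is the product of the sets `{0, …, t i}`, with `t` an exponent of top degree; this
  -- bounds the coordinate sum by `t.degree`.
  obtain ⟨x, hx, hxF⟩ := MvPolynomial.combinatorial_nullstellensatz_exists_eval_nonzero F t
    (MvPolynomial.mem_support_iff.mp ht) htd
    (fun i => (Finset.range (t i + 1)).image (Nat.cast : ℕ → K)) (fun i => by
      rw [Finset.card_image_of_injective _ Nat.cast_injective, Finset.card_range]
      omega)
  choose a ha hax using fun i => Finset.mem_image.mp (hx i)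
  refine ⟨a, ?_, by simpa only [hax] using hxF⟩
  rw [htd, Finsupp.degree_eq_sum]
  exact Finset.sum_le_sum fun i _ => Nat.lt_succ_iff.mp (Finset.mem_range.mp (ha i))

/-! ### Coordinates on projective space -/

namespace CoordRing

variable {K W ι : Type*} [Field K] [AddCommGroup W] [Module K W] [Fintype ι] [DecidableEq ι]
  (b : Module.Basis ι K W)

/-- The coordinate ring is the polynomial ring in the coordinates of a basis. -/
noncomputable def equivMvPolynomial : CoordRing K W ≃ₐ[K] MvPolynomial ι K :=
  SymmetricAlgebra.equivMvPolynomial b.dualBasis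

lemma equivMvPolynomial_symm_X (i : ι) :
    (equivMvPolynomial b).symm (MvPolynomial.X i) =
      SymmetricAlgebra.ι K (Module.Dual K W) (b.dualBasis i) :=
  SymmetricAlgebra.equivMvPolynomial_symm_X _ _

lemma evalAt_equivMvPolynomial_symm (w : W) (F : MvPolynomial ι K) :
    evalAt w ((equivMvPolynomial b).symm F) = MvPolynomial.eval (b.repr w) F := by
  have : (evalAt w).comp (equivMvPolynomial b).symm.toAlgHom = MvPolynomial.aeval (b.repr w) := by
    ext i
    simp [equivMvPolynomial_symm_X, evalAt]
  rw [← MvPolynomial.coe_aeval_eq_eval]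
  exact DFunLike.congr_fun this F

lemma forms_eq_map (n : ℕ) : forms K W n =
    (MvPolynomial.homogeneousSubmodule ι K n).map
      (equivMvPolynomial b).symm.toAlgHom.toLinearMap := by
  rw [← MvPolynomial.homogeneousSubmodule_one_pow, Submodule.map_pow, forms,
    MvPolynomial.homogeneousSubmodule_one_eq_span_X, Submodule.map_span, ← Set.range_comp,
    LinearMap.range_eq_map, ← b.dualBasis.span_eq, Submodule.map_span, ← Set.range_comp]
  congr 3
  funext i
  exact (equivMvPolynomial_symm_X b i).symm

end CoordRing

namespace ProjSubvariety

variable {K W ι : Type*} [Field K] [AddCommGroup W] [Module K W] [Fintype ι] [DecidableEq ι]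
  (Z : ProjSubvariety K W) (b : Module.Basis ι K W)

/-- The homogeneous coordinate ring of a subvariety, as a quotient of the polynomial ring. -/
noncomputable def coordHom : MvPolynomial ι K →ₐ[K] CoordRing K W ⧸ Z.ideal :=
  (Ideal.Quotient.mkₐ K Z.ideal).comp (CoordRing.equivMvPolynomial b).symm.toAlgHom

lemma coordHom_eq_zero_iff (F : MvPolynomial ι K) :
    Z.coordHom b F = 0 ↔ (CoordRing.equivMvPolynomial b).symm F ∈ Z.ideal :=
  Ideal.Quotient.eq_zero_iff_mem

lemma coordHom_surjective : Function.Surjective (Z.coordHom b) :=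
  (Ideal.Quotient.mkₐ_surjective K Z.ideal).comp (CoordRing.equivMvPolynomial b).symm.surjective

lemma coordHom_not_injective (hZ : Z.IsProper) : ¬ Function.Injective (Z.coordHom b) := by
  obtain ⟨f, hf, hf0⟩ := Submodule.exists_mem_ne_zero_of_ne_bot hZ
  intro hinj
  refine hf0 ((map_eq_zero_iff _ (CoordRing.equivMvPolynomial b).injective).mp (hinj ?_))
  rw [map_zero, coordHom_eq_zero_iff, AlgEquiv.symm_apply_apply]
  exact hf

/-- An ideal generated by forms contains the homogeneous components of its elements; this property
is carried over to the polynomial ring. -/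
lemma coordHom_homogeneousComponent (F : MvPolynomial ι K) (hF : Z.coordHom b F = 0) (n : ℕ) :
    Z.coordHom b (MvPolynomial.homogeneousComponent n F) = 0 := by
  let : GradedAlgebra (MvPolynomial.homogeneousSubmodule ι K) := MvPolynomial.gradedAlgebra
  let E := CoordRing.equivMvPolynomial b
  have hI : Z.ideal.map (E : CoordRing K W →+* MvPolynomial ι K) = Ideal.span
      (E '' {f | f ∈ Z.ideal ∧ ∃ n : ℕ, f ∈ CoordRing.forms K W n}) := by
    conv_lhs => rw [Z.homogeneous]
    rw [Ideal.map_span]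
    rfl
  have hhom : (Z.ideal.map (E : CoordRing K W →+* MvPolynomial ι K)).IsHomogeneous
      (MvPolynomial.homogeneousSubmodule ι K) := by
    rw [hI]
    refine Ideal.homogeneous_span _ _ ?_
    rintro _ ⟨f, ⟨-, m, hm⟩, rfl⟩
    rw [CoordRing.forms_eq_map b] at hm
    obtain ⟨g, hg, rfl⟩ := hm
    refine ⟨m, ?_⟩
    have : E ((CoordRing.equivMvPolynomial b).symm.toAlgHom.toLinearMap g) = g :=
      E.apply_symm_apply g
    rw [this]
    exact hg
  have hmem : ∀ G : MvPolynomial ι K, Z.coordHom b G = 0 ↔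
      G ∈ Z.ideal.map (E : CoordRing K W →+* MvPolynomial ι K) := by
    intro G
    rw [coordHom_eq_zero_iff]
    constructor
    · intro h
      have := Ideal.mem_map_of_mem (E : CoordRing K W →+* MvPolynomial ι K) h
      rwa [show (E : CoordRing K W →+* MvPolynomial ι K) (E.symm G) = G from
        E.apply_symm_apply G] at this
    · intro h
      obtain ⟨f, hf, hfG⟩ := (Ideal.mem_map_iff_of_surjective
        (E : CoordRing K W →+* MvPolynomial ι K) E.surjective).mp h
      rw [← hfG]
      exact (E.symm_apply_apply f).symm ▸ hf
  rw [hmem] at hF ⊢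
  rw [← MvPolynomial.decomposition.decompose'_apply]
  exact hhom n hF

lemma exists_coordHom_X_ne_zero : ∃ i, Z.coordHom b (MvPolynomial.X i) ≠ 0 := by
  by_contra! h
  obtain ⟨l, hl⟩ := Z.relevant
  refine hl ?_
  rw [← b.dualBasis.sum_repr l, map_sum]
  refine Z.ideal.sum_mem fun i _ => ?_
  rw [map_smul, ← CoordRing.equivMvPolynomial_symm_X]
  exact Submodule.smul_of_tower_mem _ _ ((Z.coordHom_eq_zero_iff b _).mp (h i))

lemma hilbertFunction_eq (n : ℕ) : Z.hilbertFunction n = Module.finrank K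
    ((MvPolynomial.homogeneousSubmodule ι K n).map (Z.coordHom b).toLinearMap) := by
  rw [hilbertFunction, CoordRing.forms_eq_map b, ← Submodule.map_comp]
  rfl

lemma one_lt_card {ι : Type*} [Fintype ι] (b : Module.Basis ι K W)
    (hZ : Z.IsProper) : 1 < Fintype.card ι := by
  classical
  have := Z.isPrime
  by_contra h
  have : Subsingleton ι := Fintype.card_le_one_iff_subsingleton.mp (not_lt.mp h)
  obtain ⟨i, hi⟩ := Z.exists_coordHom_X_ne_zero b
  exact hi (map_X_eq_zero_of_subsingleton _ (Z.coordHom_not_injective b hZ)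
    (Z.coordHom_homogeneousComponent b) i)

/-- A proper subvariety of degree `D` misses some nonzero point whose coordinates in a given basis
are natural numbers of sum at most `D`. -/
theorem exists_natCast_not_mem_rationalPoints [CharZero K] (hZ : Z.IsProper) {D : ℕ}
    (hD : Z.HasDegree D) :
    ∃ a : ι → ℕ, ∑ i, a i ≤ D ∧ ∃ hv : ∑ i, (a i : K) • b i ≠ 0,
      Projectivization.mk K (∑ i, (a i : K) • b i) hv ∉ Z.rationalPoints := by
  have := Z.isPrime
  obtain ⟨p, hp, hpD⟩ := hD
  simp only [Z.hilbertFunction_eq b] at hp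
  obtain ⟨F, hF0, hF, hFD⟩ := exists_mem_ker_totalDegree_le (Z.coordHom b)
    (Z.coordHom_surjective b) (Z.coordHom_not_injective b hZ)
    (Z.coordHom_homogeneousComponent b) (Z.exists_coordHom_X_ne_zero b) hp
  rw [hpD, Nat.cast_le] at hFD
  obtain ⟨a, ha, haF⟩ := MvPolynomial.exists_natCast_eval_ne_zero hF0
  have hrepr : (b.repr (∑ i, (a i : K) • b i) : ι → K) = fun i => (a i : K) := by
    rw [b.repr_sum_self]
  refine ⟨a, ha.trans hFD, fun h0 => ?_, fun hmem => ?_⟩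
  · rw [← hrepr, h0, map_zero, Finsupp.coe_zero] at haF
    exact haF (eval_zero_of_mem_homogeneous_ker _ (Z.coordHom_homogeneousComponent b) hF)
  · have := hmem _ ((Z.coordHom_eq_zero_iff b F).mp hF) (∑ i, (a i : K) • b i) (by
      rw [Projectivization.submodule_mk]
      exact Submodule.mem_span_singleton_self _)
    rw [CoordRing.evalAt_equivMvPolynomial_symm, hrepr] at this
    exact haF this

end ProjSubvariety

/-! ### Norms -/

namespace HermitianMetric

variable {K : Type*} [Field K] {V : Type*} [AddCommGroup V] [Module (𝓞 K) V]
  (h : HermitianMetric K V) (σ : K →+* ℂ)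

lemma norm_sum_nsmul_le {ι : Type*} [Fintype ι] (a : ι → ℕ) (e : ι → V) :
    h.norm σ (∑ i, a i • e i) ≤ ∑ i, (a i : ℝ) * h.norm σ (e i) := by
  let := @InnerProductSpace.Core.toNormedAddCommGroup ℂ (ComplexFiber σ V) _ _ _ (h.form σ)
  have hnorm : ∀ v : V, h.norm σ v = ‖(1 : ComplexAt σ) ⊗ₜ[𝓞 K] v‖ := fun v => rfl
  have hmap : (1 : ComplexAt σ) ⊗ₜ[𝓞 K] (∑ i, a i • e i) =
      ∑ i, a i • ((1 : ComplexAt σ) ⊗ₜ[𝓞 K] e i) := by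
    have := map_sum (TensorProduct.mk (𝓞 K) (ComplexAt σ) V 1) (fun i => a i • e i) Finset.univ
    simpa only [map_nsmul, TensorProduct.mk_apply] using this
  simp only [hnorm]
  rw [hmap]
  exact (norm_sum_le _ _).trans (Finset.sum_le_sum fun i _ => norm_nsmul_le)

/-- Flatness preserves the injectivity of `𝓞 K → ℂ`, so `V` embeds in its fiber at `σ`. -/
lemma norm_pos [Module.Flat (𝓞 K) V] {v : V} (hv : v ≠ 0) : 0 < h.norm σ v := by
  let := @InnerProductSpace.Core.toNormedAddCommGroup ℂ (ComplexFiber σ V) _ _ _ (h.form σ)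
  have hnorm : h.norm σ v = ‖(1 : ComplexAt σ) ⊗ₜ[𝓞 K] v‖ := rfl
  rw [hnorm, norm_pos_iff]
  have hinj : Function.Injective (Algebra.linearMap (𝓞 K) (ComplexAt σ)) :=
    σ.injective.comp (FaithfulSMul.algebraMap_injective (𝓞 K) K)
  intro h0
  have h1 : LinearMap.rTensor V (Algebra.linearMap (𝓞 K) (ComplexAt σ)) (1 ⊗ₜ v) = 0 := by
    rw [LinearMap.rTensor_tmul, Algebra.linearMap_apply, map_one]
    exact h0
  have h2 := (map_eq_zero_iff _
    (Module.Flat.rTensor_preserves_injective_linearMap (M := V) _ hinj)).mp h1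
  have h3 := congrArg (TensorProduct.lid (𝓞 K) V) h2
  rw [TensorProduct.lid_tmul, one_smul, map_zero] at h3
  exact hv h3

/-- The tensors `1 ⊗ v` span, so they contain a basis, and there are finitely many embeddings.
Nonemptiness allows the infimum to be approximated from above. -/
lemma exists_linearIndependent_log_norm_le [NumberField K] [Module.Finite (𝓞 K) V] :
    {l : ℝ | ∃ e : Fin (Module.finrank K (K ⊗[𝓞 K] V)) → V,
      LinearIndependent K (fun i => (1 : K) ⊗ₜ[𝓞 K] e i) ∧
      ∀ i (σ : K →+* ℂ), Real.log (h.norm σ (e i)) ≤ l}.Nonempty := by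
  obtain ⟨s, hs, hspan, hind⟩ := exists_linearIndependent K
    (Set.range fun v : V => (1 : K) ⊗ₜ[𝓞 K] v)
  have htop : Submodule.span K (Set.range fun v : V => (1 : K) ⊗ₜ[𝓞 K] v) = ⊤ := by
    rw [eq_top_iff]
    rintro x -
    induction x using TensorProduct.induction_on with
    | zero => exact zero_mem _
    | tmul k v =>
      rw [← mul_one k, ← smul_eq_mul, ← TensorProduct.smul_tmul']
      exact Submodule.smul_mem _ _ (Submodule.subset_span ⟨v, rfl⟩)
    | add x y hx hy => exact add_mem hx hy
  let B : Module.Basis s K (K ⊗[𝓞 K] V) :=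
    Module.Basis.mk hind (by rw [Subtype.range_coe, hspan, htop])
  have : Finite s := Module.Finite.finite_basis B
  have : Fintype s := Fintype.ofFinite s
  choose c hc using fun x : s => hs x.2
  let E := (Fintype.equivFinOfCardEq (Module.finrank_eq_card_basis B).symm).symm
  obtain ⟨l, hl⟩ := (Set.finite_range fun x : Fin (Module.finrank K (K ⊗[𝓞 K] V)) × (K →+* ℂ) =>
    Real.log (h.norm x.2 (c (E x.1)))).bddAbove
  refine ⟨l, fun i => c (E i), ?_, fun i σ => hl ⟨(i, σ), rfl⟩⟩
  have : (fun i => (1 : K) ⊗ₜ[𝓞 K] c (E i)) = ((↑) : s → K ⊗[𝓞 K] V) ∘ E :=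
    funext fun i => hc (E i)
  rw [this]
  exact hind.comp _ E.injective

end HermitianMetric

/-! ### The small vector off the subvariety -/

theorem proposition5 {K : Type*} [Field K] [NumberField K]
    {V : Type*} [AddCommGroup V] [Module (𝓞 K) V]
    [Module.Finite (𝓞 K) V] [Module.Projective (𝓞 K) V]
    (N : ℕ) (hN : Module.finrank (𝓞 K) V = N + 1)
    (h : HermitianMetric K V)
    (Z : ProjSubvariety K (K ⊗[𝓞 K] V)) (hZ : Z.IsProper)
    (D : ℕ) (hD : Z.HasDegree D) :
    ∃ v : V, v ≠ 0 ∧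
      (∀ σ : K →+* ℂ,
        Real.log (h.norm σ v) ≤
          h.successiveMinimum (N + 1) + Real.log ((D : ℝ) * ((N : ℝ) + 1))) ∧
      ∃ hv : (1 : K) ⊗ₜ[𝓞 K] v ≠ 0,
        Projectivization.mk K ((1 : K) ⊗ₜ[𝓞 K] v) hv ∉ Z.rationalPoints := by
  have hrank : Module.finrank K (K ⊗[𝓞 K] V) = N + 1 :=
    (TensorProduct.isBaseChange (𝓞 K) V K).finrank_eq.trans hN
  have hne := h.exists_linearIndependent_log_norm_le
  rw [hrank] at hne
  have hN1 : 0 < N := by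
    have := Z.one_lt_card (Module.finBasisOfFinrankEq K _ hrank) hZ
    rw [Fintype.card_fin] at this
    omega
  have hlogN : 0 < Real.log ((N : ℝ) + 1) := Real.log_pos (by
    have : (0 : ℝ) < N := Nat.cast_pos.mpr hN1
    linarith)
  -- Attainment of the infimum is not needed: the factor `N + 1` in the bound is spent only on this
  -- slack, positive since `N ≥ 1`.
  obtain ⟨l, ⟨e, hind, hle⟩, hl⟩ := exists_lt_of_csInf_lt hne
    (show h.successiveMinimum (N + 1) < h.successiveMinimum (N + 1) + Real.log ((N : ℝ) + 1) by
      linarith)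
  let b : Module.Basis (Fin (N + 1)) K (K ⊗[𝓞 K] V) :=
    basisOfLinearIndependentOfCardEqFinrank hind (by rw [Fintype.card_fin, hrank])
  have hb : ∀ i, b i = (1 : K) ⊗ₜ[𝓞 K] e i := fun i => by simp [b]
  obtain ⟨a, haD, hv, hmem⟩ := Z.exists_natCast_not_mem_rationalPoints b hZ hD
  have hsum : ∑ i, (a i : K) • b i = (1 : K) ⊗ₜ[𝓞 K] (∑ i, a i • e i) := by
    have := map_sum (TensorProduct.mk (𝓞 K) K V 1) (fun i => a i • e i) Finset.univ
    simp only [map_nsmul, TensorProduct.mk_apply] at this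
    rw [this]
    exact Finset.sum_congr rfl fun i _ => by rw [hb, Nat.cast_smul_eq_nsmul]
  simp only [hsum] at hv hmem
  have hv0 : ∑ i, a i • e i ≠ 0 := fun h0 => hv (by rw [h0, TensorProduct.tmul_zero])
  have hDpos : 0 < D := by
    by_contra hD0
    refine hv0 (Finset.sum_eq_zero fun i _ => ?_)
    have := Finset.single_le_sum (fun i _ => Nat.zero_le (a i)) (Finset.mem_univ i)
    rw [show a i = 0 by omega, zero_smul]
  have hDpos' : (0 : ℝ) < D := Nat.cast_pos.mpr hDpos
  refine ⟨∑ i, a i • e i, hv0, fun σ => ?_, hv, hmem⟩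
  -- The triangle inequality and the bound on the sum of the `a i`; no factor for the number of
  -- summands appears.
  have hbound : h.norm σ (∑ i, a i • e i) ≤ D * Real.exp l := by
    refine (h.norm_sum_nsmul_le σ a e).trans ?_
    calc ∑ i, (a i : ℝ) * h.norm σ (e i) ≤ ∑ i, (a i : ℝ) * Real.exp l :=
          Finset.sum_le_sum fun i _ => mul_le_mul_of_nonneg_left
            ((Real.le_exp_log _).trans (Real.exp_le_exp.mpr (hle i σ))) (Nat.cast_nonneg _)
      _ = ((∑ i, a i : ℕ) : ℝ) * Real.exp l := by rw [← Finset.sum_mul, Nat.cast_sum]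
      _ ≤ D * Real.exp l :=
          mul_le_mul_of_nonneg_right (Nat.cast_le.mpr haD) (Real.exp_pos l).le
  have hlog := Real.log_le_log (h.norm_pos σ hv0) hbound
  rw [Real.log_mul hDpos'.ne' (Real.exp_pos l).ne', Real.log_exp] at hlog
  rw [Real.log_mul hDpos'.ne' (by positivity)]
  linarith
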